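/- **Theorem 3.1.** Let $(M,P,g)$ be a Riemannian almost product manifold of dimension $2n$: $M$ is a (Hausdorff) smooth manifold, $g$ a smooth Riemannian metric and $P$ a smooth $(1,1)$-tensor field with $P^2=\mathrm{id}$, $g(Px,Py)=g(x,y)$ and $\operatorname{tr}P=0$. Let $\nabla$ be the Levi-Civita connection of $g$, put $F(x,y,z)=g((\nabla_xP)y,z)$, and let the 1-form $\theta$ and the vector field $\Omega$ be given by $\theta(x)=g^{ij}F(e_i,e_j,x)$ and $g(\Omega,x)=\theta(x)$. Assume that $(M,P,g)$ belongs to the class $\mathcal W_1$, i.e. $$F(x,y,z)=\tfrac1{2n}\{g(x,y)\theta(z)-g(x,Py)\theta(Pz)+g(x,z)\theta(y)-g(x,Pz)\theta(Py)\}.$$ Let $\lambda,\mu\in\mathbb R$ and let $\nabla'$ be the natural connection with parameters $(\lambda,\mu)$, i.e. a linear connection with $\nabla'g=0$, $\nabla'P=0$ whose torsion $T(x,y)=\nabla'_xy-\nabla'_yx-[x,y]$ satisfies $$\begin{aligned}g(T(x,y),z)={}&\tfrac1{2n}\{g(y,z)\theta(Px)-g(x,z)\theta(Py)\}\\&+\lambda\{g(y,z)\theta(x)-g(x,z)\theta(y)+g(y,Pz)\theta(Px)-g(x,Pz)\theta(Py)\}\\&+\mu\{g(y,Pz)\theta(x)-g(x,Pz)\theta(y)+g(y,z)\theta(Px)-g(x,z)\theta(Py)\}.\end{aligned}$$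 Let $R(x,y,z,w)=g(\nabla_x\nabla_yz-\nabla_y\nabla_xz-\nabla_{[x,y]}z,w)$, and let $R'$ be defined in the same way from $\nabla'$. Put $$p=\lambda\Omega+\left(\mu+\tfrac1{2n}\right)P\Omega,\qquad q=\lambda P\Omega+\mu\Omega,$$ $$U(x,w)=\lambda(\nabla'_x\theta)w+\left(\mu+\tfrac1{2n}\right)(\nabla'_x\theta)Pw,\qquad V(x,w)=\lambda(\nabla'_x\theta)Pw+\mu(\nabla'_x\theta)w,$$ $$S'(y,z)=U(y,z)-\tfrac1{2n}\{\lambda\theta(y)\theta(Pz)+\mu\theta(y)\theta(z)\},$$ $$S''(y,z)=V(y,Pz)+\tfrac1{2n}\{\lambda\theta(Py)\theta(z)+\mu\theta(Py)\theta(Pz)\},$$ and, for a $(0,2)$-tensor $S$, $$\psi_1(S)(x,y,z,w)=g(y,z)S(x,w)-g(x,z)S(y,w)+S(y,z)g(x,w)-S(x,z)g(y,w),$$ $$\psi_2(S)(x,y,z,w)=\psi_1(S)(x,y,Pz,Pw),$$ $\pi_1=\tfrac12\psi_1(g)$, $\pi_2=\tfrac12\psi_2(g)$, $\pi_3=\psi_1(\widetilde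 g)$, where $\widetilde g(x,y)=g(x,Py)$. Then, for all smooth vector fields $x,y,z,w$ on $M$, $$R=R'-g(p,p)\,\pi_1-g(q,q)\,\pi_2-g(p,q)\,\pi_3-\psi_1(S')-\psi_2(S'').$$ -/

import Mathlib

open Bundle FiberBundle
open scoped Manifold ContDiff

noncomputable section

namespace AlmostProduct

variable {E : Type*} [NormedAddCommGroup E] [NormedSpace ℝ E] [FiniteDimensional ℝ E]
  {H : Type*} [TopologicalSpace H] {I : ModelWithCorners ℝ E H}
  {M : Type*} [TopologicalSpace M] [ChartedSpace H M] [IsManifold I ∞ M]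

/-- Linear connections on the tangent bundle of `M`. On paper `cov Y m (X m)` is `(∇_X Y)(m)`. -/
abbrev Connection (I : ModelWithCorners ℝ E H) (M : Type*) [TopologicalSpace M]
    [ChartedSpace H M] [IsManifold I ∞ M] :=
  CovariantDerivative I E (fun m : M ↦ TangentSpace I m)

/-- Fields of endomorphisms of the tangent spaces, i.e. `(1,1)`-tensor fields. -/
abbrev EndoField (I : ModelWithCorners ℝ E H) (M : Type*) [TopologicalSpace M]
    [ChartedSpace H M] :=
  Π m : M, TangentSpace I m →L[ℝ] TangentSpace I m

/-- Vector fields (smoothness is required where it is needed). -/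
abbrev VField (I : ModelWithCorners ℝ E H) (M : Type*) [TopologicalSpace M] [ChartedSpace H M] :=
  Π m : M, TangentSpace I m

/-- Smoothness of a vector field. -/
def SmoothField (X : VField I M) : Prop :=
  ContMDiff I (I.prod 𝓘(ℝ, E)) ∞ (fun m ↦ TotalSpace.mk' E m (X m))

/-- Smoothness of a `(1,1)`-tensor field. -/
def SmoothEndo (P : EndoField I M) : Prop :=
  ContMDiff I (I.prod 𝓘(ℝ, E →L[ℝ] E)) ∞
    (fun m ↦ TotalSpace.mk' (E →L[ℝ] E) (E := fun m : M ↦ TangentSpace I m →L[ℝ] TangentSpace I m)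
      m (P m))

/-- The vector field `P X`. -/
def onField (P : EndoField I M) (X : VField I M) : VField I M := fun m ↦ P m (X m)

/-- The tangent vector `(∇_v P) w = ∇_v (P W) - P (∇_v W)`, where `W` is an extension of `w` to a
vector field which is smooth near `m`. -/
def covEndo (cov : Connection I M) (P : EndoField I M) (m : M) (v w : TangentSpace I m) :
    TangentSpace I m :=
  cov (onField P (extend E w)) m v - P m (cov (extend E w) m v)

/-- `(∇_v P) w` may be computed with any extension of `w`. -/
theorem covEndo_apply (cov : Connection I M) {P : EndoField I M} (hP : SmoothEndo P) (m : M)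
    (v : TangentSpace I m) {Y : VField I M}
    (hY : MDifferentiableAt I (I.prod 𝓘(ℝ, E)) (fun m ↦ TotalSpace.mk' E m (Y m)) m) :
    covEndo cov P m v (Y m) = cov (onField P Y) m v - P m (cov Y m v) := by
  have hPX : ∀ {X : VField I M},
      MDifferentiableAt I (I.prod 𝓘(ℝ, E)) (fun m ↦ TotalSpace.mk' E m (X m)) m →
      MDifferentiableAt I (I.prod 𝓘(ℝ, E)) (fun m ↦ TotalSpace.mk' E m (onField P X m)) m :=
    fun hX ↦ MDifferentiableAt.clm_bundle_apply (hP.mdifferentiableAt (by simp)) hX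
  have key : TensorialAt I E
      (fun X : VField I M ↦ cov (onField P X) m v - P m (cov X m v)) m := by
    constructor
    · intro f X hf hX
      have h : onField P (f • X) = f • onField P X := by
        funext x; simp [onField]
      simp only [h, cov.isCovariantDerivativeOn.leibniz (hPX hX) hf,
        cov.isCovariantDerivativeOn.leibniz hX hf]
      simp [onField, smul_sub]
    · intro X X' hX hX'
      have h : onField P (X + X') = onField P X + onField P X' := by
        funext x; simp [onField]
      simp only [h, cov.isCovariantDerivativeOn.add (hPX hX) (hPX hX'),
        cov.isCovariantDerivativeOn.add hX hX']
      simp only [add_apply, map_add]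
      abel
  exact key.pointwise (mdifferentiableAt_extend ..) hY (by simp)

variable [RiemannianBundle (fun m : M ↦ TangentSpace I m)]

/-- Riemannian almost product structures with vanishing trace: `P` is a smooth `(1,1)`-tensor field
with `P² = id`, `g(Px, Py) = g(x, y)` and `tr P = 0`. The metric `g` is the inner product on the
tangent spaces. -/
structure IsRiemannianAlmostProduct (P : EndoField I M) : Prop where
  smooth : SmoothEndo P
  sq : ∀ (m : M) (x : TangentSpace I m), P m (P m x) = x
  isometry : ∀ (m : M) (x y : TangentSpace I m), inner ℝ (P m x) (P m y) = inner ℝ x y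
  trace_eq_zero : ∀ m : M, LinearMap.trace ℝ (TangentSpace I m) (P m).toLinearMap = 0

section connections

variable [IsContMDiffRiemannianBundle I ∞ E (fun m : M ↦ TangentSpace I m)]

/-- `∇g = 0` for the linear connection `∇`. -/
def PreservesMetric (cov : Connection I M) : Prop :=
  @CovariantDerivative.IsMetricCompatible E _ _ H _ I M _ _ E _ _ (fun m : M ↦ TangentSpace I m) _
    (fun _ ↦ inferInstance) (fun _ ↦ inferInstance) _ cov inferInstance inferInstance inferInstance
    inferInstance

theorem preservesMetric_iff (cov : Connection I M) :
    PreservesMetric cov ↔ ∀ {m : M} {X Y Z : VField I M},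
      MDifferentiableAt I (I.prod 𝓘(ℝ, E)) (fun m ↦ TotalSpace.mk' E m (X m)) m →
      MDifferentiableAt I (I.prod 𝓘(ℝ, E)) (fun m ↦ TotalSpace.mk' E m (Y m)) m →
      MDifferentiableAt I (I.prod 𝓘(ℝ, E)) (fun m ↦ TotalSpace.mk' E m (Z m)) m →
      mvfderiv I (fun m ↦ (inner ℝ (Y m) (Z m) : ℝ)) m (X m) =
        inner ℝ (cov Y m (X m)) (Z m) + inner ℝ (Y m) (cov Z m (X m)) :=
  @CovariantDerivative.isMetricCompatible_iff E _ _ H _ I M _ _ E _ _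
    (fun m : M ↦ TangentSpace I m) _ (fun _ ↦ inferInstance) (fun _ ↦ inferInstance) _ cov
    inferInstance inferInstance inferInstance inferInstance inferInstance

/-- `cov` is the Levi-Civita connection: the (smooth) torsion-free connection with `∇g = 0`. -/
structure IsLeviCivita [CompleteSpace E] (cov : Connection I M) : Prop where
  smooth : CovariantDerivative.ContMDiffCovariantDerivative cov ∞
  torsion_eq_zero : cov.torsion = 0
  metric : PreservesMetric cov

/-- `cov` is a natural connection: a (smooth) linear connection with `∇'g = 0` and `∇'P = 0`. -/
structure IsNatural (cov : Connection I M) (P : EndoField I M) : Prop where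
  smooth : CovariantDerivative.ContMDiffCovariantDerivative cov ∞
  metric : PreservesMetric cov
  parallel : ∀ (m : M) (v w : TangentSpace I m), covEndo cov P m v w = 0

end connections

/-- The tensor `F(x, y, z) = g((∇_x P) y, z)`. -/
def tensorF (cov : Connection I M) (P : EndoField I M) (m : M) (x y z : TangentSpace I m) : ℝ :=
  inner ℝ (covEndo cov P m x y) z

instance (m : M) : FiniteDimensional ℝ (TangentSpace I m) :=
  inferInstanceAs (FiniteDimensional ℝ E)

instance (m : M) : CompleteSpace (TangentSpace I m) := FiniteDimensional.complete ℝ _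

/-- The Lee form `θ(z) = g^{ij} F(e_i, e_j, z)`, written in an orthonormal basis of the tangent
space, for which `g^{ij} = δ_{ij}`. -/
def leeForm (cov : Connection I M) (P : EndoField I M) (m : M) : TangentSpace I m →L[ℝ] ℝ :=
  LinearMap.toContinuousLinearMap
    { toFun := fun z ↦
        ∑ i, tensorF cov P m (stdOrthonormalBasis ℝ (TangentSpace I m) i)
          (stdOrthonormalBasis ℝ (TangentSpace I m) i) z
      map_add' := fun z w ↦ by simp [tensorF, inner_add_right, Finset.sum_add_distrib]
      map_smul' := fun c z ↦ by simp [tensorF, inner_smul_right, Finset.mul_sum] }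

/-- The vector `Ω` with `g(Ω, x) = θ(x)`. -/
def leeVector (cov : Connection I M) (P : EndoField I M) (m : M) : TangentSpace I m :=
  (InnerProductSpace.toDual ℝ (TangentSpace I m)).symm (leeForm cov P m)

theorem inner_leeVector (cov : Connection I M) (P : EndoField I M) (m : M)
    (x : TangentSpace I m) : inner ℝ (leeVector cov P m) x = leeForm cov P m x := by
  simp [leeVector]

/-- The defining condition of the class `W₁`, where `dim M = 2n`; `cov` is the Levi-Civita
connection. -/
def IsW1 (n : ℕ) (cov : Connection I M) (P : EndoField I M) : Prop :=
  ∀ (m : M) (x y z : TangentSpace I m),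
    tensorF cov P m x y z = 1 / (2 * (n : ℝ)) *
      (inner ℝ x y * leeForm cov P m z - inner ℝ x (P m y) * leeForm cov P m (P m z)
        + inner ℝ x z * leeForm cov P m y - inner ℝ x (P m z) * leeForm cov P m (P m y))

/-- The torsion `T(x, y, z) = g(T(x, y), z)` of the connection `cov'` is the one with parameters
`(lam, mu)`; `cov` is the Levi-Civita connection, through which `θ` is defined. -/
def HasParameters [CompleteSpace E] (n : ℕ) (cov : Connection I M) (P : EndoField I M)
    (lam mu : ℝ) (cov' : Connection I M) : Prop :=
  ∀ (m : M) (x y z : TangentSpace I m),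
    inner ℝ (cov'.torsion m x y) z =
      1 / (2 * (n : ℝ)) *
        (inner ℝ y z * leeForm cov P m (P m x) - inner ℝ x z * leeForm cov P m (P m y))
      + lam *
        (inner ℝ y z * leeForm cov P m x - inner ℝ x z * leeForm cov P m y
          + inner ℝ y (P m z) * leeForm cov P m (P m x)
          - inner ℝ x (P m z) * leeForm cov P m (P m y))
      + mu *
        (inner ℝ y (P m z) * leeForm cov P m x - inner ℝ x (P m z) * leeForm cov P m y
          + inner ℝ y z * leeForm cov P m (P m x) - inner ℝ x z * leeForm cov P m (P m y))

/-- `p = λ Ω + (μ + 1/2n) P Ω`. -/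
def vecP (n : ℕ) (cov : Connection I M) (P : EndoField I M) (lam mu : ℝ) : VField I M := fun m ↦
  lam • leeVector cov P m + (mu + 1 / (2 * (n : ℝ))) • P m (leeVector cov P m)

/-- `q = λ P Ω + μ Ω`. -/
def vecQ (cov : Connection I M) (P : EndoField I M) (lam mu : ℝ) : VField I M := fun m ↦
  lam • P m (leeVector cov P m) + mu • leeVector cov P m

/-- `(∇_X α) Y = X(α(Y)) - α(∇_X Y)` for a 1-form `α`. -/
def covForm (cov : Connection I M) (α : Π m : M, TangentSpace I m →L[ℝ] ℝ) (X Y : VField I M)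
    (m : M) : ℝ :=
  mvfderiv I (fun m ↦ α m (Y m)) m (X m) - α m (cov Y m (X m))

/-- The value of a `(0,2)`-tensor on two vector fields, as a function on `M`. -/
abbrev Form2 (I : ModelWithCorners ℝ E H) (M : Type*) [TopologicalSpace M] [ChartedSpace H M] :=
  VField I M → VField I M → M → ℝ

/-- The metric `g`. -/
def metricG : Form2 I M := fun X Y m ↦ inner ℝ (X m) (Y m)

/-- The associated metric `g(x, P y)`. -/
def metricAssoc (P : EndoField I M) : Form2 I M := fun X Y ↦ metricG X (onField P Y)

/-- `U(x, w) = λ (∇'_x θ) w + (μ + 1/2n) (∇'_x θ) P w`. -/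
def formU (n : ℕ) (cov : Connection I M) (P : EndoField I M) (lam mu : ℝ)
    (cov' : Connection I M) : Form2 I M := fun X W m ↦
  lam * covForm cov' (leeForm cov P) X W m
    + (mu + 1 / (2 * (n : ℝ))) * covForm cov' (leeForm cov P) X (onField P W) m

/-- `V(x, w) = λ (∇'_x θ) P w + μ (∇'_x θ) w`. -/
def formV (cov : Connection I M) (P : EndoField I M) (lam mu : ℝ)
    (cov' : Connection I M) : Form2 I M := fun X W m ↦
  lam * covForm cov' (leeForm cov P) X (onField P W) m
    + mu * covForm cov' (leeForm cov P) X W m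

/-- `S'(y, z) = U(y, z) - (1/2n) {λ θ(y) θ(P z) + μ θ(y) θ(z)}`. -/
def formS' (n : ℕ) (cov : Connection I M) (P : EndoField I M) (lam mu : ℝ)
    (cov' : Connection I M) : Form2 I M := fun Y Z m ↦
  formU n cov P lam mu cov' Y Z m - 1 / (2 * (n : ℝ)) *
    (lam * leeForm cov P m (Y m) * leeForm cov P m (P m (Z m))
      + mu * leeForm cov P m (Y m) * leeForm cov P m (Z m))

/-- `S''(y, z) = V(y, P z) + (1/2n) {λ θ(P y) θ(z) + μ θ(P y) θ(P z)}`. -/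
def formS'' (n : ℕ) (cov : Connection I M) (P : EndoField I M) (lam mu : ℝ)
    (cov' : Connection I M) : Form2 I M := fun Y Z m ↦
  formV cov P lam mu cov' Y (onField P Z) m + 1 / (2 * (n : ℝ)) *
    (lam * leeForm cov P m (P m (Y m)) * leeForm cov P m (Z m)
      + mu * leeForm cov P m (P m (Y m)) * leeForm cov P m (P m (Z m)))

/-- `ψ₁(S)(x,y,z,w) = g(y,z) S(x,w) - g(x,z) S(y,w) + S(y,z) g(x,w) - S(x,z) g(y,w)`. -/
def psi1 (S : Form2 I M) (X Y Z W : VField I M) (m : M) : ℝ :=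
  metricG Y Z m * S X W m - metricG X Z m * S Y W m
    + S Y Z m * metricG X W m - S X Z m * metricG Y W m

/-- `ψ₂(S)(x,y,z,w) = ψ₁(S)(x,y,Pz,Pw)`. -/
def psi2 (P : EndoField I M) (S : Form2 I M) (X Y Z W : VField I M) (m : M) : ℝ :=
  psi1 S X Y (onField P Z) (onField P W) m

def pi1 (X Y Z W : VField I M) (m : M) : ℝ := 1 / 2 * psi1 metricG X Y Z W m

def pi2 (P : EndoField I M) (X Y Z W : VField I M) (m : M) : ℝ := 1 / 2 * psi2 P metricG X Y Z W m

def pi3 (P : EndoField I M) (X Y Z W : VField I M) (m : M) : ℝ := psi1 (metricAssoc P) X Y Z W m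

/-- The curvature tensor `R(x,y,z,w) = g(∇_x ∇_y z - ∇_y ∇_x z - ∇_{[x,y]} z, w)` of a linear
connection. -/
def curvature (cov : Connection I M) (X Y Z W : VField I M) (m : M) : ℝ :=
  inner ℝ
    (cov (fun m ↦ cov Z m (Y m)) m (X m) - cov (fun m ↦ cov Z m (X m)) m (Y m)
      - cov Z m (VectorField.mlieBracket I X Y m)) (W m)

end AlmostProduct

end

/-! Write `D(y,z) = ∇'_y z - ∇_y z`. A connection preserving `g` is determined by its torsion, so
the prescribed torsion forces `D(y,z) = g(y,z)p - g(p,z)y + g(y,Pz)q - g(q,z)Py` (`cov_sub_cov`).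
Substituting `∇ = ∇' - D` into `R`, and `[x,y] = ∇'_x y - ∇'_y x - T(x,y)`, leaves `R'` together
with two kinds of terms.

The terms linear in `D` are the antisymmetrized `∇'D`. Since `g` and `P` are `∇'`-parallel, only `p`
and `q` get differentiated, which produces `U` and `V` (`inner_cov_diffField`). The quadratic terms
`D_x D_y z - D_y D_x z - D(T(x,y),z)` are pointwise algebra (`inner_diffVec_commutator`): they give
the `π_i` parts and, because `p = Pq + (1/2n)PΩ`, the `θ ⊗ θ` corrections in `S'` and `S''`.

The analytic point is that `θ` is differentiable. It is defined through a basis chosen separately at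
each point, so this is not immediate; it follows by solving the `W₁` identity for `θ` in terms of
`F` (`mdifferentiableAt_leeForm`). -/

namespace AlmostProduct

/-! ### Algebra in a single tangent space. -/

section algebra

variable {V : Type*} [NormedAddCommGroup V] [InnerProductSpace ℝ V]

/-- `g(y, z) p - g(p, z) y + g(y, P z) q - g(q, z) P y`: the difference `∇'_y z - ∇_y z` of the
natural connection and the Levi-Civita connection. -/
def diffVec (P : V →L[ℝ] V) (p q y z : V) : V :=
  inner ℝ y z • p - (inner ℝ p z : ℝ) • y + (inner ℝ y (P z) : ℝ) • q - (inner ℝ q z : ℝ) • P y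

theorem diffVec_sub_left (P : V →L[ℝ] V) (p q y y' z : V) :
    diffVec P p q (y - y') z = diffVec P p q y z - diffVec P p q y' z := by
  simp only [diffVec, map_sub, inner_sub_left]
  module

theorem diffVec_sub_right (P : V →L[ℝ] V) (p q y z z' : V) :
    diffVec P p q y (z - z') = diffVec P p q y z - diffVec P p q y z' := by
  simp only [diffVec, map_sub, inner_sub_right]
  module

theorem inner_map_left {P : V →L[ℝ] V} (hsq : ∀ x, P (P x) = x)
    (hiso : ∀ x y, inner ℝ (P x) (P y) = (inner ℝ x y : ℝ)) (x y : V) :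
    inner ℝ (P x) y = (inner ℝ x (P y) : ℝ) := by
  rw [← hiso x (P y), hsq]

/-- Trace zero excludes `P = ± id`, so both eigenvalues `1` and `-1` occur, with orthogonal
eigenvectors `u` and `v`. For `a = u + v` the expression equals `-4 g(u,u) g(v,v)`. It serves as the
determinant of the linear system that is solved for `θ`. -/
theorem exists_inner_map_sq_ne [FiniteDimensional ℝ V] [Nontrivial V] {P : V →L[ℝ] V}
    (hsq : ∀ x, P (P x) = x) (hiso : ∀ x y, inner ℝ (P x) (P y) = (inner ℝ x y : ℝ))
    (htr : LinearMap.trace ℝ V P.toLinearMap = 0) :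
    ∃ a : V, (inner ℝ a (P a) : ℝ) ^ 2 - (inner ℝ a a : ℝ) ^ 2 ≠ 0 := by
  have hdim : (Module.finrank ℝ V : ℝ) ≠ 0 := by
    exact_mod_cast (Module.finrank_pos (R := ℝ) (M := V)).ne'
  obtain ⟨u, hu, hPu⟩ : ∃ u : V, u ≠ 0 ∧ P u = u := by
    by_contra! h
    refine hdim ?_
    have : P.toLinearMap = -LinearMap.id := by
      ext x
      -- Since `P² = id`, the vector `x + Px` is fixed by `P`.
      have hx : x + P x = 0 := by
        by_contra hx
        exact h _ hx (by rw [map_add, hsq, add_comm])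
      simpa using (neg_eq_of_add_eq_zero_right hx).symm
    simpa [this] using htr
  obtain ⟨v, hv, hPv⟩ : ∃ v : V, v ≠ 0 ∧ P v = -v := by
    by_contra! h
    refine hdim ?_
    have : P.toLinearMap = LinearMap.id := by
      ext x
      have hx : x - P x = 0 := by
        by_contra hx
        exact h _ hx (by rw [map_sub, hsq, neg_sub])
      simpa using (sub_eq_zero.mp hx).symm
    simpa [this] using htr
  have huv : (inner ℝ u v : ℝ) = 0 := by
    have := hiso u v
    rw [hPu, hPv, inner_neg_right] at this
    linarith
  refine ⟨u + v, ?_⟩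
  have h1 := (real_inner_self_pos (F := V)).mpr hu
  have h2 := (real_inner_self_pos (F := V)).mpr hv
  rw [map_add, hPu, hPv]
  simp only [inner_add_left, inner_add_right, inner_neg_right, huv, real_inner_comm u v]
  have := mul_pos h1 h2
  nlinarith

/-- The quadratic part of the curvature difference. The parameter `c` stands for `1/2n` and measures
the failure of `p = Pq`; the terms carrying `c` become the `θ ⊗ θ` corrections in `S'` and `S''`. -/
theorem inner_diffVec_commutator {P : V →L[ℝ] V} (hsq : ∀ x, P (P x) = x)
    (hiso : ∀ x y, inner ℝ (P x) (P y) = (inner ℝ x y : ℝ)) (c l u : ℝ) (O x y z w p q : V)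
    (hp : p = l • O + (u + c) • P O) (hq : q = l • P O + u • O) :
    (inner ℝ (diffVec P p q x (diffVec P p q y z)) w : ℝ)
        - inner ℝ (diffVec P p q y (diffVec P p q x z)) w
        - inner ℝ (diffVec P p q (diffVec P p q x y - diffVec P p q y x) z) w =
      - inner ℝ p p * (inner ℝ y z * inner ℝ x w - inner ℝ x z * inner ℝ y w)
      - inner ℝ q q * (inner ℝ y (P z) * inner ℝ x (P w) - inner ℝ x (P z) * inner ℝ y (P w))
      - inner ℝ p q * (inner ℝ y z * inner ℝ x (P w) - inner ℝ x z * inner ℝ y (P w)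
          + inner ℝ y (P z) * inner ℝ x w - inner ℝ x (P z) * inner ℝ y w)
      + c * (inner ℝ y z * (inner ℝ O x * (l * inner ℝ O (P w) + u * inner ℝ O w))
          - inner ℝ x z * (inner ℝ O y * (l * inner ℝ O (P w) + u * inner ℝ O w))
          + inner ℝ x w * (inner ℝ O y * (l * inner ℝ O (P z) + u * inner ℝ O z))
          - inner ℝ y w * (inner ℝ O x * (l * inner ℝ O (P z) + u * inner ℝ O z)))
      - c * (inner ℝ y (P z) * (inner ℝ O (P x) * (l * inner ℝ O (P w) + u * inner ℝ O w))
          - inner ℝ x (P z) * (inner ℝ O (P y) * (l * inner ℝ O (P w) + u * inner ℝ O w))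
          + inner ℝ x (P w) * (inner ℝ O (P y) * (l * inner ℝ O (P z) + u * inner ℝ O z))
          - inner ℝ y (P w) * (inner ℝ O (P x) * (l * inner ℝ O (P z) + u * inner ℝ O z))) := by
  have hP := inner_map_left hsq hiso
  have hc (a b : V) : (inner ℝ a (P b) : ℝ) = inner ℝ b (P a) := by rw [← hP, real_inner_comm]
  subst hp hq
  simp only [diffVec, map_add, map_sub, map_smul, inner_add_left, inner_sub_left, inner_add_right,
    inner_sub_right, inner_smul_left, inner_smul_right, hP, hsq, conj_trivial]
  -- `g` and `g(·, P·)` are both symmetric; fixing one order for each pair of arguments leaves a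
  -- polynomial identity.
  simp only [real_inner_comm O x, real_inner_comm O y, real_inner_comm x y, hc x O, hc y O, hc y x]
  ring

end algebra

/-! ### Differentiating products and combinations of scalar functions. -/

section functions

variable {E : Type*} [NormedAddCommGroup E] [NormedSpace ℝ E]
  {H : Type*} [TopologicalSpace H] {I : ModelWithCorners ℝ E H}
  {M : Type*} [TopologicalSpace M] [ChartedSpace H M] {f f' g g' : M → ℝ} {m : M}

/-- Near `m` the function `f` is the quotient `fg / g`. This is the division by the determinant when
solving for `θ`. -/
theorem mdifferentiableAt_of_mul (hg : MDifferentiableAt I 𝓘(ℝ, ℝ) g m) (hm : g m ≠ 0)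
    (hfg : MDifferentiableAt I 𝓘(ℝ, ℝ) (fun m ↦ f m * g m) m) :
    MDifferentiableAt I 𝓘(ℝ, ℝ) f m := by
  have hinv : MDifferentiableAt I 𝓘(ℝ, ℝ) (fun m ↦ (g m)⁻¹) m :=
    (differentiableAt_inv hm).comp_mdifferentiableAt hg
  refine (hfg.mul hinv).congr_of_eventuallyEq ?_
  filter_upwards [hg.continuousAt.eventually_ne hm] with y hy
  simp [hy]

theorem mvfderiv_linear_combination (a b : ℝ)
    (hf : MDifferentiableAt I 𝓘(ℝ, ℝ) f m) (hg : MDifferentiableAt I 𝓘(ℝ, ℝ) g m)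
    (v : TangentSpace I m) :
    mvfderiv I (fun m ↦ a * f m + b * g m) m v = a * mvfderiv I f m v + b * mvfderiv I g m v := by
  have h (c : ℝ) : MDifferentiableAt I 𝓘(ℝ, ℝ) (fun _ : M ↦ c) m := mdifferentiableAt_const
  have hf' : MDifferentiableAt I 𝓘(ℝ, ℝ) (fun m ↦ a * f m) m := (h a).mul hf
  have hg' : MDifferentiableAt I 𝓘(ℝ, ℝ) (fun m ↦ b * g m) m := (h b).mul hg
  rw [mvfderiv_fun_add hf' hg', mvfderiv_fun_mul (h a) hf, mvfderiv_fun_mul (h b) hg]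
  simp [mvfderiv_const]

theorem mdifferentiableAt_mul_sub_mul
    (hf : MDifferentiableAt I 𝓘(ℝ, ℝ) f m) (hf' : MDifferentiableAt I 𝓘(ℝ, ℝ) f' m)
    (hg : MDifferentiableAt I 𝓘(ℝ, ℝ) g m) (hg' : MDifferentiableAt I 𝓘(ℝ, ℝ) g' m) :
    MDifferentiableAt I 𝓘(ℝ, ℝ) (fun m ↦ f m * f' m - g m * g' m) m :=
  (hf.mul hf').sub (hg.mul hg')

theorem mvfderiv_mul_sub_mul
    (hf : MDifferentiableAt I 𝓘(ℝ, ℝ) f m) (hf' : MDifferentiableAt I 𝓘(ℝ, ℝ) f' m)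
    (hg : MDifferentiableAt I 𝓘(ℝ, ℝ) g m) (hg' : MDifferentiableAt I 𝓘(ℝ, ℝ) g' m)
    (v : TangentSpace I m) :
    mvfderiv I (fun m ↦ f m * f' m - g m * g' m) m v =
      f m * mvfderiv I f' m v + f' m * mvfderiv I f m v
        - (g m * mvfderiv I g' m v + g' m * mvfderiv I g m v) := by
  have h1 : MDifferentiableAt I 𝓘(ℝ, ℝ) (fun m ↦ f m * f' m) m := hf.mul hf'
  have h2 : MDifferentiableAt I 𝓘(ℝ, ℝ) (fun m ↦ g m * g' m) m := hg.mul hg'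
  rw [mvfderiv_fun_sub h1 h2, mvfderiv_fun_mul hf hf', mvfderiv_fun_mul hg hg']
  simp

end functions

/-! ### Smooth vector fields and the tensor `F`. -/

section fields

variable {E : Type*} [NormedAddCommGroup E] [NormedSpace ℝ E] [FiniteDimensional ℝ E]
  {H : Type*} [TopologicalSpace H] {I : ModelWithCorners ℝ E H}
  {M : Type*} [TopologicalSpace M] [ChartedSpace H M] [IsManifold I ∞ M]

/-- `extend E v` has constant coordinates in the trivialization at `m`; a bump function supported in
the chart makes it globally smooth. -/
theorem exists_smoothField [T2Space M] (m : M) (v : TangentSpace I m) :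
    ∃ S : VField I M, SmoothField S ∧ S m = v := by
  let f : SmoothBumpFunction I m := Classical.arbitrary _
  refine ⟨(f : M → ℝ) • extend E v, ?_, by simp⟩
  let e := trivializationAt E (fun m : M ↦ TangentSpace I m) m
  have he : e.baseSet = (chartAt H m).source := rfl
  refine ContMDiffOn.smul_section_of_tsupport f.contMDiff.contMDiffOn e.open_baseSet
    (he ▸ f.tsupport_subset_chartAt_source) ?_
  rw [e.contMDiffOn_section_baseSet_iff]
  refine (contMDiffOn_const (c := (e ⟨m, v⟩).2)).congr fun y hy ↦ ?_
  simp [extend, e, e.apply_mk_symm hy]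

omit [FiniteDimensional ℝ E]

theorem SmoothField.mdifferentiableAt {X : VField I M} (hX : SmoothField X) (m : M) :
    MDifferentiableAt I (I.prod 𝓘(ℝ, E)) (fun m ↦ TotalSpace.mk' E m (X m)) m :=
  ContMDiff.mdifferentiableAt hX (by simp)

theorem SmoothField.onField {P : EndoField I M} (hP : SmoothEndo P) {X : VField I M}
    (hX : SmoothField X) : SmoothField (onField P X) :=
  ContMDiff.clm_bundle_apply hP hX

theorem SmoothField.cov {cov : Connection I M}
    (hcov : CovariantDerivative.ContMDiffCovariantDerivative cov ∞) {X Y : VField I M}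
    (hX : SmoothField X) (hY : SmoothField Y) : SmoothField (fun m ↦ cov Y m (X m)) :=
  ContMDiff.clm_bundle_apply
    (contMDiffOn_univ.1 (hcov.contMDiff.contMDiff (contMDiffOn_univ.2 (hY.of_le (by simp))))) hX

theorem SmoothField.sub {X Y : VField I M} (hX : SmoothField X) (hY : SmoothField Y) :
    SmoothField (fun m ↦ X m - Y m) :=
  ContMDiff.sub_section hX hY

variable [RiemannianBundle (fun m : M ↦ TangentSpace I m)]
  [IsContMDiffRiemannianBundle I ∞ E (fun m : M ↦ TangentSpace I m)]

theorem mdifferentiableAt_inner {X Y : VField I M} {m : M}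
    (hX : MDifferentiableAt I (I.prod 𝓘(ℝ, E)) (fun m ↦ TotalSpace.mk' E m (X m)) m)
    (hY : MDifferentiableAt I (I.prod 𝓘(ℝ, E)) (fun m ↦ TotalSpace.mk' E m (Y m)) m) :
    MDifferentiableAt I 𝓘(ℝ, ℝ) (fun m ↦ (inner ℝ (X m) (Y m) : ℝ)) m :=
  MDifferentiableAt.inner_bundle hX hY

variable [FiniteDimensional ℝ E]

theorem mdifferentiableAt_tensorF {cov : Connection I M} {P : EndoField I M}
    (hcov : CovariantDerivative.ContMDiffCovariantDerivative cov ∞) (hP : SmoothEndo P)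
    {X Y Z : VField I M} (hX : SmoothField X) (hY : SmoothField Y) (hZ : SmoothField Z) (m : M) :
    MDifferentiableAt I 𝓘(ℝ, ℝ) (fun m ↦ tensorF cov P m (X m) (Y m) (Z m)) m := by
  have h (m : M) : tensorF cov P m (X m) (Y m) (Z m) =
      inner ℝ (cov (onField P Y) m (X m) - onField P (fun m ↦ cov Y m (X m)) m) (Z m) := by
    rw [tensorF, covEndo_apply cov hP m _ (hY.mdifferentiableAt m)]
    rfl
  simp only [h]
  exact mdifferentiableAt_inner
    (((hX.cov hcov (hY.onField hP)).sub ((hX.cov hcov hY).onField hP)).mdifferentiableAt m)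
    (hZ.mdifferentiableAt m)

end fields

/-! ### Differentiability of the Lee form. -/

section leeForm

variable {E : Type*} [NormedAddCommGroup E] [NormedSpace ℝ E] [FiniteDimensional ℝ E]
  {H : Type*} [TopologicalSpace H] {I : ModelWithCorners ℝ E H}
  {M : Type*} [TopologicalSpace M] [ChartedSpace H M] [IsManifold I ∞ M]
  [RiemannianBundle (fun m : M ↦ TangentSpace I m)]
  [IsContMDiffRiemannianBundle I ∞ E (fun m : M ↦ TangentSpace I m)]
  {n : ℕ} {cov : Connection I M} {P : EndoField I M}

omit [FiniteDimensional ℝ E]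
  [IsContMDiffRiemannianBundle I ∞ E (fun m : M ↦ TangentSpace I m)] in
theorem IsRiemannianAlmostProduct.inner_left (hP : IsRiemannianAlmostProduct P) (m : M)
    (x y : TangentSpace I m) : inner ℝ (P m x) y = (inner ℝ x (P m y) : ℝ) :=
  inner_map_left (hP.sq m) (hP.isometry m) x y

theorem mdifferentiableAt_leeForm_of_inner_ne
    (hcov : CovariantDerivative.ContMDiffCovariantDerivative cov ∞)
    (hP : IsRiemannianAlmostProduct P) (hn : n ≠ 0) (hW1 : IsW1 n cov P) {S : VField I M}
    (hS : SmoothField S) {m : M}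
    (hm : (inner ℝ (S m) (P m (S m)) : ℝ) ^ 2 - (inner ℝ (S m) (S m) : ℝ) ^ 2 ≠ 0) :
    MDifferentiableAt I 𝓘(ℝ, ℝ) (fun m ↦ leeForm cov P m (S m)) m := by
  have hPS := hS.onField hP.smooth
  have h1 := mdifferentiableAt_inner (hS.mdifferentiableAt m) (hPS.mdifferentiableAt m)
  have h2 := mdifferentiableAt_inner (hS.mdifferentiableAt m) (hS.mdifferentiableAt m)
  have h3 := mdifferentiableAt_tensorF hcov hP.smooth hS hS hS m
  have h4 := mdifferentiableAt_tensorF hcov hP.smooth hPS hS hS m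
  have hn' : (n : ℝ) ≠ 0 := by exact_mod_cast hn
  -- With `a = g(S,S)` and `b = g(S,PS)`, the `W₁` identity gives `n F(S,S,S) = a θ(S) - b θ(PS)`
  -- and `n F(PS,S,S) = b θ(S) - a θ(PS)`. Eliminating `θ(PS)` yields `(b² - a²) θ(S)`.
  refine mdifferentiableAt_of_mul ((h1.pow 2).sub (h2.pow 2)) hm
    (((h1.mul h4).sub (h2.mul h3)).const_smul (n : ℝ) |>.congr_of_eventuallyEq (.of_forall ?_))
  intro y
  simp [-inner_self_eq_norm_sq_to_K, hW1 y, onField, hP.sq, hP.inner_left]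
  field_simp
  ring

theorem mdifferentiableAt_leeForm [T2Space M]
    (hcov : CovariantDerivative.ContMDiffCovariantDerivative cov ∞)
    (hP : IsRiemannianAlmostProduct P) (hn : Module.finrank ℝ E = 2 * n) (hW1 : IsW1 n cov P)
    {Z : VField I M} (hZ : SmoothField Z) (m : M) :
    MDifferentiableAt I 𝓘(ℝ, ℝ) (fun m ↦ leeForm cov P m (Z m)) m := by
  rcases subsingleton_or_nontrivial E with hE | hE
  -- In dimension zero there is no vector with nonzero determinant, but every field vanishes.
  · have hZ0 (y : M) : Z y = 0 := Subsingleton.elim (α := E) _ _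
    simpa [hZ0] using mdifferentiableAt_const
  have : Nontrivial (TangentSpace I m) := hE
  have hn' : (n : ℝ) ≠ 0 := by
    have := Module.finrank_pos (R := ℝ) (M := E)
    exact_mod_cast (by omega : n ≠ 0)
  obtain ⟨a, ha⟩ := exists_inner_map_sq_ne (hP.sq m) (hP.isometry m) (hP.trace_eq_zero m)
  obtain ⟨S, hS, rfl⟩ := exists_smoothField m a
  have hPS := hS.onField hP.smooth
  have hPZ := hZ.onField hP.smooth
  have h1 := mdifferentiableAt_inner (hS.mdifferentiableAt m) (hPS.mdifferentiableAt m)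
  have h2 := mdifferentiableAt_inner (hS.mdifferentiableAt m) (hS.mdifferentiableAt m)
  have h3 := mdifferentiableAt_tensorF hcov hP.smooth hS hS hZ m
  have h4 := mdifferentiableAt_tensorF hcov hP.smooth hPS hS hZ m
  have h5 := mdifferentiableAt_inner (hS.mdifferentiableAt m) (hZ.mdifferentiableAt m)
  have h6 := mdifferentiableAt_inner (hS.mdifferentiableAt m) (hPZ.mdifferentiableAt m)
  have h7 := mdifferentiableAt_leeForm_of_inner_ne hcov hP (by exact_mod_cast hn') hW1 hS ha
  -- Replacing `S` by `PS` leaves both `g(S,S)` and `g(S,PS)` unchanged.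
  have h8 := mdifferentiableAt_leeForm_of_inner_ne hcov hP (by exact_mod_cast hn') hW1 hPS (m := m)
    (by simpa [-inner_self_eq_norm_sq_to_K, onField, hP.sq, hP.inner_left] using ha)
  -- Once `θ(S)` and `θ(PS)` are known, `hA` and `hB` concern `a θ(Z) - b θ(PZ)` and `b θ(Z) - a
  -- θ(PZ)`: the same system, now with unknowns `θ(Z)` and `θ(PZ)`.
  have hA := ((h3.const_smul (2 * n : ℝ)).sub (h5.mul h7)).add (h6.mul h8)
  have hB := ((h4.const_smul (2 * n : ℝ)).sub (h6.mul h7)).add (h5.mul h8)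
  refine mdifferentiableAt_of_mul ((h1.pow 2).sub (h2.pow 2)) ha
    (((h1.mul hB).sub (h2.mul hA)).congr_of_eventuallyEq (.of_forall ?_))
  intro y
  simp [-inner_self_eq_norm_sq_to_K, hW1 y, onField, hP.sq, hP.inner_left]
  field_simp
  ring

end leeForm

/-! ### The difference tensor and its covariant derivative. -/

section difference

variable {E : Type*} [NormedAddCommGroup E] [NormedSpace ℝ E] [FiniteDimensional ℝ E]
  {H : Type*} [TopologicalSpace H] {I : ModelWithCorners ℝ E H}
  {M : Type*} [TopologicalSpace M] [ChartedSpace H M] [IsManifold I ∞ M]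
  [RiemannianBundle (fun m : M ↦ TangentSpace I m)]
  [IsContMDiffRiemannianBundle I ∞ E (fun m : M ↦ TangentSpace I m)]
  {n : ℕ} {cov cov' : Connection I M} {P : EndoField I M} {lam mu : ℝ}

theorem PreservesMetric.mvfderiv_inner (h : PreservesMetric cov) {Y Z : VField I M} {m : M}
    (hY : MDifferentiableAt I (I.prod 𝓘(ℝ, E)) (fun m ↦ TotalSpace.mk' E m (Y m)) m)
    (hZ : MDifferentiableAt I (I.prod 𝓘(ℝ, E)) (fun m ↦ TotalSpace.mk' E m (Z m)) m)
    (v : TangentSpace I m) :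
    mvfderiv I (fun m ↦ (inner ℝ (Y m) (Z m) : ℝ)) m v =
      inner ℝ (cov Y m v) (Z m) + inner ℝ (Y m) (cov Z m v) := by
  simpa using (preservesMetric_iff cov).1 h (mdifferentiableAt_extend I E v) hY hZ

theorem IsNatural.cov_onField (h : IsNatural cov P) (hP : SmoothEndo P) {Y : VField I M} {m : M}
    (hY : MDifferentiableAt I (I.prod 𝓘(ℝ, E)) (fun m ↦ TotalSpace.mk' E m (Y m)) m)
    (v : TangentSpace I m) : cov (onField P Y) m v = P m (cov Y m v) :=
  sub_eq_zero.1 ((covEndo_apply cov hP m v hY).symm.trans (h.parallel m v (Y m)))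

omit [IsContMDiffRiemannianBundle I ∞ E (fun m : M ↦ TangentSpace I m)] in
theorem inner_vecP (hP : IsRiemannianAlmostProduct P) (m : M) (w : TangentSpace I m) :
    (inner ℝ (vecP n cov P lam mu m) w : ℝ) =
      lam * leeForm cov P m w + (mu + 1 / (2 * (n : ℝ))) * leeForm cov P m (P m w) := by
  simp [vecP, inner_add_left, inner_smul_left, hP.inner_left, inner_leeVector]

omit [IsContMDiffRiemannianBundle I ∞ E (fun m : M ↦ TangentSpace I m)] in
theorem inner_vecQ (hP : IsRiemannianAlmostProduct P) (m : M) (w : TangentSpace I m) :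
    (inner ℝ (vecQ cov P lam mu m) w : ℝ) =
      lam * leeForm cov P m (P m w) + mu * leeForm cov P m w := by
  simp [vecQ, inner_add_left, inner_smul_left, hP.inner_left, inner_leeVector]

/-- The difference tensor of the natural connection and the Levi-Civita connection. -/
noncomputable def diffField (n : ℕ) (cov : Connection I M) (P : EndoField I M) (lam mu : ℝ) (Y Z : VField I M) :
    VField I M := fun m ↦
  diffVec (P m) (vecP n cov P lam mu m) (vecQ cov P lam mu m) (Y m) (Z m)

omit [IsContMDiffRiemannianBundle I ∞ E (fun m : M ↦ TangentSpace I m)] in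
theorem HasParameters.torsion_eq [CompleteSpace E] (hpar : HasParameters n cov P lam mu cov')
    (hP : IsRiemannianAlmostProduct P) (m : M) (x y : TangentSpace I m) :
    cov'.torsion m x y =
      diffVec (P m) (vecP n cov P lam mu m) (vecQ cov P lam mu m) x y
        - diffVec (P m) (vecP n cov P lam mu m) (vecQ cov P lam mu m) y x := by
  refine ext_inner_right ℝ fun z ↦ ?_
  rw [hpar m x y z]
  simp only [diffVec, inner_sub_left, inner_add_left, inner_smul_left, conj_trivial,
    inner_vecP hP, inner_vecQ hP, hP.inner_left]
  -- The terms along `p` and `q` are symmetric in `x` and `y`, as `P` is self-adjoint, and cancel.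
  rw [← hP.inner_left m x y, real_inner_comm x y, real_inner_comm (P m x) y]
  ring

/-- The Koszul argument: both sides, paired with `z`, are skew in the last two arguments and have
the same alternation in the first two, namely the torsion. A trilinear form skew in one pair and
symmetric in the other is zero. -/
theorem cov_sub_cov [CompleteSpace E] (hcov : IsLeviCivita cov) (hnat : IsNatural cov' P)
    (hpar : HasParameters n cov P lam mu cov') (hP : IsRiemannianAlmostProduct P)
    {Y : VField I M} {m : M}
    (hY : MDifferentiableAt I (I.prod 𝓘(ℝ, E)) (fun m ↦ TotalSpace.mk' E m (Y m)) m)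
    (v : TangentSpace I m) :
    cov' Y m v - cov Y m v =
      diffVec (P m) (vecP n cov P lam mu m) (vecQ cov P lam mu m) v (Y m) := by
  refine ext_inner_right ℝ fun z ↦ ?_
  obtain ⟨X, hX, rfl⟩ : ∃ X : VField I M, MDifferentiableAt I (I.prod 𝓘(ℝ, E))
      (fun m ↦ TotalSpace.mk' E m (X m)) m ∧ X m = v :=
    ⟨extend E v, mdifferentiableAt_extend I E v, by simp⟩
  obtain ⟨Z, hZ, rfl⟩ : ∃ Z : VField I M, MDifferentiableAt I (I.prod 𝓘(ℝ, E))
      (fun m ↦ TotalSpace.mk' E m (Z m)) m ∧ Z m = z :=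
    ⟨extend E z, mdifferentiableAt_extend I E z, by simp⟩
  have skew {A B : VField I M}
      (hA : MDifferentiableAt I (I.prod 𝓘(ℝ, E)) (fun m ↦ TotalSpace.mk' E m (A m)) m)
      (hB : MDifferentiableAt I (I.prod 𝓘(ℝ, E)) (fun m ↦ TotalSpace.mk' E m (B m)) m)
      (u : TangentSpace I m) :
      (inner ℝ (cov' A m u - cov A m u) (B m) : ℝ) = - inner ℝ (cov' B m u - cov B m u) (A m) := by
    have h := (hnat.metric.mvfderiv_inner hA hB u).symm.trans (hcov.metric.mvfderiv_inner hA hB u)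
    rw [real_inner_comm (A m)]
    simp only [inner_sub_left, inner_sub_right]
    linarith
  have tors {A B : VField I M}
      (hA : MDifferentiableAt I (I.prod 𝓘(ℝ, E)) (fun m ↦ TotalSpace.mk' E m (A m)) m)
      (hB : MDifferentiableAt I (I.prod 𝓘(ℝ, E)) (fun m ↦ TotalSpace.mk' E m (B m)) m)
      (u : TangentSpace I m) :
      (inner ℝ (cov' B m (A m) - cov B m (A m)) u : ℝ)
        - inner ℝ (cov' A m (B m) - cov A m (B m)) u = inner ℝ (cov'.torsion m (A m) (B m)) u := by
    have h : cov.torsion m (A m) (B m) = 0 := by simp [hcov.torsion_eq_zero]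
    rw [cov.torsion_apply hA hB] at h
    rw [cov'.torsion_apply hA hB, ← inner_sub_left]
    congr 1
    rw [← sub_eq_zero, ← neg_eq_zero, ← h]
    abel
  have h1 := tors hX hY (Z m)
  have h2 := tors hY hZ (X m)
  have h3 := tors hZ hX (Y m)
  have h4 := skew hX hY (Z m)
  have h5 := skew hX hZ (Y m)
  have h6 := skew hY hZ (X m)
  rw [hpar.torsion_eq hP] at h1 h2 h3
  have key (x y z : TangentSpace I m) :
      (inner ℝ (diffVec (P m) (vecP n cov P lam mu m) (vecQ cov P lam mu m) x y) z : ℝ) =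
        - inner ℝ (diffVec (P m) (vecP n cov P lam mu m) (vecQ cov P lam mu m) x z) y := by
    simp only [diffVec, inner_sub_left, inner_add_left, inner_smul_left, conj_trivial,
      hP.inner_left]
    ring
  simp only [inner_sub_left (diffVec _ _ _ _ _)] at h1 h2 h3
  have k1 := key (X m) (Y m) (Z m)
  have k2 := key (Y m) (X m) (Z m)
  have k3 := key (Z m) (X m) (Y m)
  linarith

variable [T2Space M]

theorem mdifferentiableAt_inner_vecP
    (hcov : CovariantDerivative.ContMDiffCovariantDerivative cov ∞)
    (hP : IsRiemannianAlmostProduct P) (hn : Module.finrank ℝ E = 2 * n) (hW1 : IsW1 n cov P)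
    {W : VField I M} (hW : SmoothField W) (m : M) :
    MDifferentiableAt I 𝓘(ℝ, ℝ) (fun m ↦ (inner ℝ (vecP n cov P lam mu m) (W m) : ℝ)) m := by
  simp only [inner_vecP hP]
  exact ((mdifferentiableAt_leeForm hcov hP hn hW1 hW m).const_smul lam).add
    ((mdifferentiableAt_leeForm hcov hP hn hW1 (hW.onField hP.smooth) m).const_smul _)

theorem mdifferentiableAt_inner_vecQ
    (hcov : CovariantDerivative.ContMDiffCovariantDerivative cov ∞)
    (hP : IsRiemannianAlmostProduct P) (hn : Module.finrank ℝ E = 2 * n) (hW1 : IsW1 n cov P)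
    {W : VField I M} (hW : SmoothField W) (m : M) :
    MDifferentiableAt I 𝓘(ℝ, ℝ) (fun m ↦ (inner ℝ (vecQ cov P lam mu m) (W m) : ℝ)) m := by
  simp only [inner_vecQ hP]
  exact ((mdifferentiableAt_leeForm hcov hP hn hW1 (hW.onField hP.smooth) m).const_smul lam).add
    ((mdifferentiableAt_leeForm hcov hP hn hW1 hW m).const_smul mu)

theorem mvfderiv_inner_vecP
    (hcov : CovariantDerivative.ContMDiffCovariantDerivative cov ∞)
    (hP : IsRiemannianAlmostProduct P) (hn : Module.finrank ℝ E = 2 * n) (hW1 : IsW1 n cov P)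
    (hnat : IsNatural cov' P) (X : VField I M) {W : VField I M} (hW : SmoothField W) (m : M) :
    mvfderiv I (fun m ↦ (inner ℝ (vecP n cov P lam mu m) (W m) : ℝ)) m (X m) =
      formU n cov P lam mu cov' X W m
        + inner ℝ (vecP n cov P lam mu m) (cov' W m (X m)) := by
  simp only [inner_vecP hP]
  refine (mvfderiv_linear_combination _ _ (mdifferentiableAt_leeForm hcov hP hn hW1 hW m)
    (mdifferentiableAt_leeForm hcov hP hn hW1 (hW.onField hP.smooth) m) _).trans ?_
  simp only [formU, covForm, hnat.cov_onField hP.smooth (hW.mdifferentiableAt m)]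
  ring

theorem mvfderiv_inner_vecQ
    (hcov : CovariantDerivative.ContMDiffCovariantDerivative cov ∞)
    (hP : IsRiemannianAlmostProduct P) (hn : Module.finrank ℝ E = 2 * n) (hW1 : IsW1 n cov P)
    (hnat : IsNatural cov' P) (X : VField I M) {W : VField I M} (hW : SmoothField W) (m : M) :
    mvfderiv I (fun m ↦ (inner ℝ (vecQ cov P lam mu m) (W m) : ℝ)) m (X m) =
      formV cov P lam mu cov' X W m + inner ℝ (vecQ cov P lam mu m) (cov' W m (X m)) := by
  simp only [inner_vecQ hP]
  refine (mvfderiv_linear_combination _ _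
    (mdifferentiableAt_leeForm hcov hP hn hW1 (hW.onField hP.smooth) m)
    (mdifferentiableAt_leeForm hcov hP hn hW1 hW m) _).trans ?_
  simp only [formV, covForm, hnat.cov_onField hP.smooth (hW.mdifferentiableAt m)]
  ring

omit [T2Space M] in
theorem diffField_eq [CompleteSpace E] (hcov : IsLeviCivita cov) (hnat : IsNatural cov' P)
    (hpar : HasParameters n cov P lam mu cov') (hP : IsRiemannianAlmostProduct P)
    (Y : VField I M) {Z : VField I M} (hZ : SmoothField Z) :
    diffField n cov P lam mu Y Z = fun m ↦ cov' Z m (Y m) - cov Z m (Y m) :=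
  funext fun m ↦ (cov_sub_cov hcov hnat hpar hP (hZ.mdifferentiableAt m) (Y m)).symm

/-- The Leibniz rule for `∇'_x (D(y,z))`. Metric compatibility reduces it to differentiating the
scalar `g(D(y,z),w)`, so `p` and `q` enter only through `g(p,·)` and `g(q,·)`, whose derivatives
come from those of `θ`. -/
theorem inner_cov_diffField [CompleteSpace E] (hcov : IsLeviCivita cov) (hnat : IsNatural cov' P)
    (hpar : HasParameters n cov P lam mu cov') (hP : IsRiemannianAlmostProduct P)
    (hn : Module.finrank ℝ E = 2 * n) (hW1 : IsW1 n cov P) (X : VField I M) {Y Z W : VField I M}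
    (hY : SmoothField Y) (hZ : SmoothField Z) (hW : SmoothField W) (m : M) :
    (inner ℝ (cov' (diffField n cov P lam mu Y Z) m (X m)) (W m) : ℝ) =
      inner ℝ (diffVec (P m) (vecP n cov P lam mu m) (vecQ cov P lam mu m)
          (cov' Y m (X m)) (Z m)) (W m)
        + inner ℝ (diffVec (P m) (vecP n cov P lam mu m) (vecQ cov P lam mu m)
          (Y m) (cov' Z m (X m))) (W m)
        + inner ℝ (Y m) (Z m) * formU n cov P lam mu cov' X W m
        - formU n cov P lam mu cov' X Z m * inner ℝ (Y m) (W m)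
        + inner ℝ (Y m) (P m (Z m)) * formV cov P lam mu cov' X W m
        - formV cov P lam mu cov' X Z m * inner ℝ (Y m) (P m (W m)) := by
  have hD : SmoothField (diffField n cov P lam mu Y Z) := by
    -- Smoothness of `D(Y,Z)` comes from the two connections, not from `p` and `q`.
    rw [diffField_eq hcov hnat hpar hP Y hZ]
    exact (hY.cov hnat.smooth hZ).sub (hY.cov hcov.smooth hZ)
  have hmet := hnat.metric.mvfderiv_inner (hD.mdifferentiableAt m) (hW.mdifferentiableAt m) (X m)
  have hPZ := hZ.onField hP.smooth
  have hPW := hW.onField hP.smooth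
  have hYm := hY.mdifferentiableAt m
  have e (y : M) : (inner ℝ (diffField n cov P lam mu Y Z y) (W y) : ℝ) =
      (inner ℝ (Y y) (Z y) * inner ℝ (vecP n cov P lam mu y) (W y)
        - inner ℝ (vecP n cov P lam mu y) (Z y) * inner ℝ (Y y) (W y))
      + (inner ℝ (Y y) (onField P Z y) * inner ℝ (vecQ cov P lam mu y) (W y)
        - inner ℝ (vecQ cov P lam mu y) (Z y) * inner ℝ (Y y) (onField P W y)) := by
    simp only [diffField, diffVec, inner_sub_left, inner_add_left, inner_smul_left, conj_trivial,
      hP.inner_left, onField]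
    ring
  have d1 := mdifferentiableAt_inner hYm (hZ.mdifferentiableAt m)
  have d2 := mdifferentiableAt_inner hYm (hW.mdifferentiableAt m)
  have d3 := mdifferentiableAt_inner hYm (hPZ.mdifferentiableAt m)
  have d4 := mdifferentiableAt_inner hYm (hPW.mdifferentiableAt m)
  have d5 := mdifferentiableAt_inner_vecP (lam := lam) (mu := mu) hcov.smooth hP hn hW1 hW m
  have d6 := mdifferentiableAt_inner_vecP (lam := lam) (mu := mu) hcov.smooth hP hn hW1 hZ m
  have d7 := mdifferentiableAt_inner_vecQ (lam := lam) (mu := mu) hcov.smooth hP hn hW1 hW m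
  have d8 := mdifferentiableAt_inner_vecQ (lam := lam) (mu := mu) hcov.smooth hP hn hW1 hZ m
  rw [eq_sub_of_add_eq hmet.symm]
  simp only [e]
  rw [mvfderiv_fun_add (mdifferentiableAt_mul_sub_mul d1 d5 d6 d2)
    (mdifferentiableAt_mul_sub_mul d3 d7 d8 d4), add_apply, mvfderiv_mul_sub_mul d1 d5 d6 d2,
    mvfderiv_mul_sub_mul d3 d7 d8 d4]
  simp only [mvfderiv_inner_vecP hcov.smooth hP hn hW1 hnat X hZ,
    mvfderiv_inner_vecP hcov.smooth hP hn hW1 hnat X hW,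
    mvfderiv_inner_vecQ hcov.smooth hP hn hW1 hnat X hZ,
    mvfderiv_inner_vecQ hcov.smooth hP hn hW1 hnat X hW,
    hnat.metric.mvfderiv_inner hYm (hZ.mdifferentiableAt m),
    hnat.metric.mvfderiv_inner hYm (hW.mdifferentiableAt m),
    hnat.metric.mvfderiv_inner hYm (hPZ.mdifferentiableAt m),
    hnat.metric.mvfderiv_inner hYm (hPW.mdifferentiableAt m),
    hnat.cov_onField hP.smooth (hZ.mdifferentiableAt m),
    hnat.cov_onField hP.smooth (hW.mdifferentiableAt m)]
  simp only [diffField, diffVec, inner_sub_left, inner_add_left, inner_smul_left, conj_trivial,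
    hP.inner_left, onField]
  ring

omit [T2Space M] in
theorem inner_cov_cov [CompleteSpace E] (hcov : IsLeviCivita cov) (hnat : IsNatural cov' P)
    (hpar : HasParameters n cov P lam mu cov') (hP : IsRiemannianAlmostProduct P)
    (X : VField I M) {Y Z : VField I M} (hY : SmoothField Y) (hZ : SmoothField Z) (W : VField I M)
    (m : M) :
    (inner ℝ (cov (fun m ↦ cov Z m (Y m)) m (X m)) (W m) : ℝ) =
      inner ℝ (cov' (fun m ↦ cov' Z m (Y m)) m (X m)) (W m)
        - inner ℝ (cov' (diffField n cov P lam mu Y Z) m (X m)) (W m)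
        - inner ℝ (diffVec (P m) (vecP n cov P lam mu m) (vecQ cov P lam mu m)
          (X m) (cov' Z m (Y m))) (W m)
        + inner ℝ (diffVec (P m) (vecP n cov P lam mu m) (vecQ cov P lam mu m) (X m)
          (diffVec (P m) (vecP n cov P lam mu m) (vecQ cov P lam mu m) (Y m) (Z m))) (W m) := by
  have hcZ := hY.cov hcov.smooth hZ
  have hD : SmoothField (diffField n cov P lam mu Y Z) := by
    rw [diffField_eq hcov hnat hpar hP Y hZ]
    exact (hY.cov hnat.smooth hZ).sub hcZ
  have hsum : (fun m ↦ cov' Z m (Y m)) =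
      (fun m ↦ cov Z m (Y m)) + diffField n cov P lam mu Y Z := by
    rw [diffField_eq hcov hnat hpar hP Y hZ]
    ext m
    simp
  have h1 := cov_sub_cov hcov hnat hpar hP (hcZ.mdifferentiableAt m) (X m)
  have h2 := cov_sub_cov hcov hnat hpar hP (hZ.mdifferentiableAt m) (Y m)
  have h3 : cov (fun m ↦ cov Z m (Y m)) m (X m) = cov' (fun m ↦ cov Z m (Y m)) m (X m)
      - diffVec (P m) (vecP n cov P lam mu m) (vecQ cov P lam mu m) (X m) (cov Z m (Y m)) := by
    rw [← h1]; abel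
  have h4 : cov Z m (Y m) = cov' Z m (Y m)
      - diffVec (P m) (vecP n cov P lam mu m) (vecQ cov P lam mu m) (Y m) (Z m) := by
    rw [← h2]; abel
  rw [hsum, cov'.isCovariantDerivativeOn.add (hcZ.mdifferentiableAt m) (hD.mdifferentiableAt m),
    h3, h4, diffVec_sub_right, add_apply]
  simp only [inner_add_left, inner_sub_left]
  ring

end difference

end AlmostProduct

/-! ### Assembling the curvature identity. -/

open AlmostProduct in
theorem theorem3p1 (n : ℕ) {M : Type*} [TopologicalSpace M] [T2Space M]
    [ChartedSpace (EuclideanSpace ℝ (Fin (2 * n))) M] [IsManifold (𝓡 (2 * n)) ∞ M]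
    [RiemannianBundle (fun m : M ↦ TangentSpace (𝓡 (2 * n)) m)]
    [IsContMDiffRiemannianBundle (𝓡 (2 * n)) ∞ (EuclideanSpace ℝ (Fin (2 * n)))
      (fun m : M ↦ TangentSpace (𝓡 (2 * n)) m)]
    (P : EndoField (𝓡 (2 * n)) M) (hP : IsRiemannianAlmostProduct P)
    (cov : Connection (𝓡 (2 * n)) M) (hcov : IsLeviCivita cov)
    (hW1 : IsW1 n cov P)
    (lam mu : ℝ) (cov' : Connection (𝓡 (2 * n)) M) (hnat : IsNatural cov' P)
    (hpar : HasParameters n cov P lam mu cov')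
    (X Y Z W : VField (𝓡 (2 * n)) M) (hX : SmoothField X) (hY : SmoothField Y)
    (hZ : SmoothField Z) (hW : SmoothField W) (m : M) :
    curvature cov X Y Z W m =
      curvature cov' X Y Z W m
        - metricG (vecP n cov P lam mu) (vecP n cov P lam mu) m * pi1 X Y Z W m
        - metricG (vecQ cov P lam mu) (vecQ cov P lam mu) m * pi2 P X Y Z W m
        - metricG (vecP n cov P lam mu) (vecQ cov P lam mu) m * pi3 P X Y Z W m
        - psi1 (formS' n cov P lam mu cov') X Y Z W m
        - psi2 P (formS'' n cov P lam mu cov') X Y Z W m := by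
  have hn : Module.finrank ℝ (EuclideanSpace ℝ (Fin (2 * n))) = 2 * n := by simp
  have c1 := inner_cov_cov hcov hnat hpar hP X hY hZ W m
  have c2 := inner_cov_cov hcov hnat hpar hP Y hX hZ W m
  rw [inner_cov_diffField hcov hnat hpar hP hn hW1 X hY hZ hW m] at c1
  rw [inner_cov_diffField hcov hnat hpar hP hn hW1 Y hX hZ hW m] at c2
  have c3 := congrArg (fun v ↦ (inner ℝ v (W m) : ℝ)) (cov_sub_cov hcov hnat hpar hP
    (hZ.mdifferentiableAt m) (VectorField.mlieBracket (𝓡 (2 * n)) X Y m))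
  -- The definition of the torsion of `∇'`, solved for the bracket.
  have hbr : VectorField.mlieBracket (𝓡 (2 * n)) X Y m =
      cov' Y m (X m) - cov' X m (Y m) -
        (diffVec (P m) (vecP n cov P lam mu m) (vecQ cov P lam mu m) (X m) (Y m)
          - diffVec (P m) (vecP n cov P lam mu m) (vecQ cov P lam mu m) (Y m) (X m)) := by
    rw [← hpar.torsion_eq hP, cov'.torsion_apply (hX.mdifferentiableAt m) (hY.mdifferentiableAt m)]
    abel
  have hPP : onField P (onField P W) = W := funext fun y ↦ hP.sq y (W y)
  have hPZ : onField P (onField P Z) = Z := funext fun y ↦ hP.sq y (Z y)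
  have alg := inner_diffVec_commutator (hP.sq m) (hP.isometry m) (1 / (2 * (n : ℝ))) lam mu
    (leeVector cov P m) (X m) (Y m) (Z m) (W m)
    (vecP n cov P lam mu m) (vecQ cov P lam mu m) rfl rfl
  have c4 := congrArg (fun v ↦ (inner ℝ (diffVec (P m) (vecP n cov P lam mu m)
    (vecQ cov P lam mu m) v (Z m)) (W m) : ℝ)) hbr
  -- Only the outer differences are split: `D(T(x,y),z)` must stay whole to match `alg`.
  simp only [diffVec_sub_left (P m) _ _ (_ - _), diffVec_sub_left (P m) _ _ (cov' Y m (X m))] at c4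
  simp only [inner_sub_left, inner_leeVector] at c3 c4 alg
  simp only [curvature, inner_sub_left, psi1, psi2, pi1, pi2, pi3, metricG, metricAssoc, formS',
    formS'', hPP, hPZ]
  simp only [onField, hP.sq]
  -- The terms `D(∇'_x y, z)` cancel against `c4`, and `D(y, ∇'_x z)` cancels between `c1` and `c2`.
  linear_combination c1 - c2 + c3 + c4 + alg
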